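/- Let $R$ be a commutative noetherian local ring, and let $I$ and $J$ be ideals of $R$ with $J\neq R$. For an $R$-module $M$ put $$\Gamma_{I,J}(M)=\{x\in M \mid I^n x\subseteq Jx \text{ for some integer } n\ge 0\},$$ a submodule of $M$; this defines a left exact additive functor $\Gamma_{I,J}$ from $R$-modules to $R$-modules (acting on homomorphisms by restriction), and $H^i_{I,J}$ denotes its $i$-th right derived functor, $i\ge 0$. Krull dimension is denoted $\dim$, and the zero module (and the zero ring) has dimension $-1$. (1) If $M$ is a finitely generated $R$-module, then $H^i_{I,J}(M)=0$ for every integer $i\ge 0$ with $i>\dim M/JM$. (2) If $M$ is an arbitrary $R$-module, not necessarily finitely generated, then $H^i_{I,J}(M)=0$ for every integer $i\ge 0$ with $i>\dim R/J$. -/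

import Mathlib

open CategoryTheory

universe u

namespace PairLocalCohomology

variable {R : Type u} [CommRing R]

/-- For an element `x` of a module, `I ^ n x ⊆ J x` if and only if `I ^ n ⊆ Ann x + J`. -/
theorem pow_smul_le_iff (I J : Ideal R) {M : Type u} [AddCommGroup M] [Module R M] (x : M)
    (n : ℕ) : (∀ a ∈ I ^ n, ∃ b ∈ J, a • x = b • x) ↔
      I ^ n ≤ (LinearMap.toSpanSingleton R M x).ker ⊔ J := by
  constructor
  · intro h a ha
    obtain ⟨b, hb, hab⟩ := h a ha
    refine Submodule.mem_sup.2 ⟨a - b, ?_, b, hb, by ring⟩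
    simp [sub_smul, hab]
  · intro h a ha
    obtain ⟨c, hc, b, hb, rfl⟩ := Submodule.mem_sup.1 (h ha)
    refine ⟨b, hb, ?_⟩
    have hc' : c • x = 0 := by simpa using hc
    rw [add_smul, hc', zero_add]

/-- The `(I, J)`-torsion submodule `Γ_{I,J}(M)`: the elements `x` of `M` with `I ^ n x ⊆ J x`
for some `n` (equivalently, for all large `n`). -/
def torsion (I J : Ideal R) (M : Type u) [AddCommGroup M] [Module R M] : Submodule R M where
  carrier := {x | ∃ n : ℕ, ∀ a ∈ I ^ n, ∃ b ∈ J, a • x = b • x}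
  zero_mem' := ⟨0, fun _ _ => ⟨0, J.zero_mem, by simp⟩⟩
  add_mem' := by
    rintro x y ⟨n, hn⟩ ⟨m, hm⟩
    refine ⟨n + m, (pow_smul_le_iff I J _ _).2 ?_⟩
    rw [pow_smul_le_iff] at hn hm
    rw [pow_add]
    refine (Ideal.mul_mono hn hm).trans (Ideal.mul_le.2 ?_)
    intro a ha b hb
    obtain ⟨c, hc, d, hd, rfl⟩ := Submodule.mem_sup.1 ha
    obtain ⟨e, he, f, hf, rfl⟩ := Submodule.mem_sup.1 hb
    have hc' : c • x = 0 := by simpa using hc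
    have he' : e • y = 0 := by simpa using he
    refine Submodule.mem_sup.2 ⟨c * e, ?_, c * f + d * (e + f),
      J.add_mem (J.mul_mem_left _ hf) (J.mul_mem_right _ hd), by ring⟩
    have h1 : (c * e) • x = 0 := by rw [mul_comm, mul_smul, hc', smul_zero]
    have h2 : (c * e) • y = 0 := by rw [mul_smul, he', smul_zero]
    simp [h1, h2]
  smul_mem' := by
    rintro r x ⟨n, hn⟩
    refine ⟨n, fun a ha => ?_⟩
    obtain ⟨b, hb, h⟩ := hn a ha
    exact ⟨b, hb, by rw [smul_comm, h, smul_comm]⟩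

theorem map_mem_torsion (I J : Ideal R) {M N : Type u} [AddCommGroup M] [Module R M]
    [AddCommGroup N] [Module R N] (f : M →ₗ[R] N) {x : M} (hx : x ∈ torsion I J M) :
    f x ∈ torsion I J N := by
  obtain ⟨n, hn⟩ := hx
  refine ⟨n, fun a ha => ?_⟩
  obtain ⟨b, hb, h⟩ := hn a ha
  exact ⟨b, hb, by rw [← map_smul, h, map_smul]⟩

/-- The `(I, J)`-torsion functor `Γ_{I,J}` from `R`-modules to `R`-modules; on morphisms it is
restriction. -/
def torsionFunctor (I J : Ideal R) : ModuleCat.{u} R ⥤ ModuleCat.{u} R where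
  obj M := ModuleCat.of R (torsion I J M)
  map f := ModuleCat.ofHom (f.hom.restrict fun _ hx => map_mem_torsion I J f.hom hx)
  map_id _ := rfl
  map_comp _ _ := rfl

instance (I J : Ideal R) : (torsionFunctor I J).Additive where
  map_add := rfl

/-- The `i`-th local cohomology functor `H^i_{I,J}` with respect to `(I, J)`: the `i`-th right
derived functor of `Γ_{I,J}`. -/
noncomputable def localCohomology (I J : Ideal R) (i : ℕ) : ModuleCat.{u} R ⥤ ModuleCat.{u} R :=
  (torsionFunctor I J).rightDerived i

end PairLocalCohomology

/-! Let 𝔠 annihilate M, with J + 𝔠 proper and dim R/(J + 𝔠) ≤ i. In an injective resolution of M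
take an (I, J)-torsion cocycle z ≠ 0 of degree i + 1 and put 𝔞 = Ann z, so that I^n ⊆ 𝔞 + J for some
n. As R is local, prime avoidance gives a set s of at most i elements of 𝔞 with 𝔞 ⊆ √((s) + J + 𝔠)
(`exists_finset_le_radical`).

Let 𝔟 = (𝔞 ∩ 𝔠) + (s). Ordinary local cohomology H^j_𝔟(M) vanishes for j > |s|: the ideal 𝔞 ∩ 𝔠
kills M, and each further generator costs one degree (`TorsionExact.sup_span_finset`). Since 𝔟 kills
z, z = dw with w 𝔟-power torsion. A prime containing Ann w + J contains 𝔟, hence 𝔞, hence I; so w is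
(I, J)-torsion. The two claims are the cases 𝔠 = Ann M and 𝔠 = 0. -/

namespace PairLocalCohomology

open Ideal

/-! ### Divisibility in injective modules -/

section Injective

variable {R : Type u} [CommRing R] [IsNoetherianRing R]

/-- Over a noetherian ring, every element `v` of an injective module is divisible by powers of `x`
up to `x`-power torsion, with a quotient that is annihilated by the annihilator of `v`. -/
theorem exists_pow_smul_eq {E : Type u} [AddCommGroup E] [Module R E] [Module.Injective R E]
    (v : E) (x : R) (n : ℕ) :
    ∃ (m : ℕ) (u : E), x ^ (m + n) • u = x ^ m • v ∧ torsionOf R E v ≤ torsionOf R E u := by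
  let A : ℕ →o Ideal R :=
    ⟨fun m => torsionOf R E (x ^ m • v), monotone_nat_of_le_succ fun m r hr => by
      rw [mem_torsionOf_iff] at hr ⊢
      rw [pow_succ', mul_smul, smul_comm, hr, smul_zero]⟩
  obtain ⟨m, hm⟩ := monotone_stabilizes_iff_noetherian.2 ‹IsNoetherianRing R› A
  let N := Submodule.span R {v}
  let N' := Submodule.span R {x ^ m • v}
  have hN : ∀ y ∈ N', x ^ n • y ∈ N := fun y hy => by
    obtain ⟨r, rfl⟩ := Submodule.mem_span_singleton.1 hy
    exact N.smul_mem _ (N.smul_mem _ (N.smul_mem _ (Submodule.mem_span_singleton_self v)))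
  -- Multiplication by `x ^ n` is injective on `N'` since the annihilators have stabilized;
  -- extending the inclusion of `N'` along it yields `u`.
  let f : N' →ₗ[R] N := (LinearMap.lsmul R E (x ^ n)).restrict hN
  have hf : Function.Injective f := by
    rw [← LinearMap.ker_eq_bot, LinearMap.ker_eq_bot']
    rintro ⟨y, hy⟩ h
    obtain ⟨r, rfl⟩ := Submodule.mem_span_singleton.1 hy
    have h' : x ^ n • r • x ^ m • v = 0 := congrArg Subtype.val h
    have : r ∈ A (m + n) := by
      change r • x ^ (m + n) • v = 0
      rw [← h', pow_add, mul_comm, mul_smul, smul_comm]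
    rw [← hm (m + n) (Nat.le_add_right _ _)] at this
    exact Subtype.ext this
  obtain ⟨h, hh⟩ := Module.Injective.out f hf N'.subtype
  refine ⟨m, h ⟨v, Submodule.mem_span_singleton_self v⟩, ?_, fun r hr => ?_⟩
  · rw [← map_smul]
    refine Eq.trans (congrArg h (Subtype.ext ?_))
      (hh ⟨x ^ m • v, Submodule.mem_span_singleton_self _⟩)
    change x ^ (m + n) • v = x ^ n • x ^ m • v
    rw [pow_add, mul_comm, mul_smul]
  · rw [mem_torsionOf_iff] at hr ⊢
    rw [← map_smul]
    exact (congrArg h (Subtype.ext hr)).trans (map_zero h)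

end Injective

/-! ### Power torsion of injective resolutions -/

section Complex

variable {R : Type u} [CommRing R] {E : ℕ → Type u} [∀ n, AddCommGroup (E n)]
  [∀ n, Module R (E n)]

/-- The `𝔟`-power torsion of the sequence `d` of linear maps is exact in degrees `> k`. -/
def TorsionExact (d : ∀ n, E n →ₗ[R] E (n + 1)) (𝔟 : Ideal R) (k : ℕ) : Prop :=
  ∀ i, k ≤ i → ∀ z : E (i + 1), d (i + 1) z = 0 → 𝔟 ≤ (torsionOf R (E (i + 1)) z).radical →
    ∃ w : E i, d i w = z ∧ 𝔟 ≤ (torsionOf R (E i) w).radical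

theorem mem_radical_torsionOf {N : Type*} [AddCommGroup N] [Module R N] {x : R} {z : N} :
    x ∈ (torsionOf R N z).radical ↔ ∃ n : ℕ, x ^ n • z = 0 :=
  Iff.rfl

theorem torsionOf_le_torsionOf_map {N P : Type*} [AddCommGroup N] [Module R N] [AddCommGroup P]
    [Module R P] (f : N →ₗ[R] P) (z : N) : torsionOf R N z ≤ torsionOf R P (f z) := fun r hr => by
  rw [mem_torsionOf_iff] at hr ⊢
  rw [← map_smul, hr, map_zero]

theorem torsionOf_inf_le_torsionOf_sub {N : Type*} [AddCommGroup N] [Module R N] (y z : N) :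
    torsionOf R N y ⊓ torsionOf R N z ≤ torsionOf R N (y - z) := fun r hr => by
  obtain ⟨hy, hz⟩ := hr
  change r • y = 0 at hy
  change r • z = 0 at hz
  rw [mem_torsionOf_iff, smul_sub, hy, hz, sub_zero]

theorem torsionOf_le_torsionOf_smul {N : Type*} [AddCommGroup N] [Module R N] (r : R) (z : N) :
    torsionOf R N z ≤ torsionOf R N (r • z) :=
  torsionOf_le_torsionOf_map (LinearMap.lsmul R N r) z

variable {d : ∀ n, E n →ₗ[R] E (n + 1)} {𝔟 : Ideal R} {k : ℕ}

/-- If `w` becomes a boundary after multiplication with a power of `x`, then it can be modified by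
a boundary so as to become `x`-power torsion. -/
theorem exists_sub_mem_radical [IsNoetherianRing R] {N P : Type u} [AddCommGroup N] [Module R N]
    [AddCommGroup P] [Module R P] [Module.Injective R N] (f : N →ₗ[R] P) {x : R} {n : ℕ} {v : N}
    {w : P} (h : f v = x ^ n • w) (hv : 𝔟 ≤ (torsionOf R N v).radical)
    (hw : 𝔟 ≤ (torsionOf R P w).radical) :
    ∃ u : N, 𝔟 ⊔ span {x} ≤ (torsionOf R P (w - f u)).radical := by
  obtain ⟨m, u, hu, hvu⟩ := exists_pow_smul_eq v x n
  refine ⟨u, sup_le ?_ ?_⟩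
  · refine (le_inf hw (hv.trans (radical_mono
      (hvu.trans (torsionOf_le_torsionOf_map f u))))).trans ?_
    rw [← radical_inf]
    exact radical_mono (torsionOf_inf_le_torsionOf_sub _ _)
  · rw [span_singleton_le_iff_mem, mem_radical_torsionOf]
    refine ⟨m + n, ?_⟩
    rw [smul_sub, ← map_smul, hu, map_smul, h, pow_add, mul_smul, sub_self]

theorem TorsionExact.sup_span_singleton [IsNoetherianRing R] [∀ n, Module.Injective R (E n)]
    (hd : ∀ n e, d (n + 1) (d n e) = 0) (h : TorsionExact d 𝔟 k) (x : R) :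
    TorsionExact d (𝔟 ⊔ span {x}) (k + 1) := by
  rintro (_ | i) hi z hz hzx
  · omega
  obtain ⟨w, rfl, hw⟩ := h (i + 1) (by omega) z hz (le_sup_left.trans hzx)
  obtain ⟨n, hn⟩ := mem_radical_torsionOf.1 (hzx (mem_sup_right (mem_span_singleton_self x)))
  -- The cocycle `x ^ n • w` lies one degree below `z`, whence the shift from `k` to `k + 1`.
  obtain ⟨v, hv, hv'⟩ := h i (by omega) (x ^ n • w) (by rw [map_smul, hn])
    (hw.trans (radical_mono (torsionOf_le_torsionOf_smul _ _)))
  obtain ⟨u, hu⟩ := exists_sub_mem_radical (d i) hv hv' hw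
  exact ⟨w - d i u, by rw [map_sub, hd, sub_zero], hu⟩

theorem TorsionExact.sup_span_finset [IsNoetherianRing R] [∀ n, Module.Injective R (E n)]
    (hd : ∀ n e, d (n + 1) (d n e) = 0) (h : TorsionExact d 𝔟 k) (s : Finset R) :
    TorsionExact d (𝔟 ⊔ span s) (k + s.card) := by
  classical
  induction s using Finset.induction_on with
  | empty => simpa using h
  | insert x s hx ih =>
    have := ih.sup_span_singleton hd x
    rwa [sup_assoc, ← span_union, Set.union_singleton, ← Finset.coe_insert, add_assoc,
      ← Finset.card_insert_of_notMem hx] at this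

/-- No degree is lost: in degree 0 the cocycle `x ^ n • w` is itself killed by `x`, so `w` needs no
correction. -/
theorem TorsionExact.sup_span_singleton_of_smul_eq_zero [IsNoetherianRing R]
    [∀ n, Module.Injective R (E n)] (hd : ∀ n e, d (n + 1) (d n e) = 0) (h : TorsionExact d 𝔟 0)
    {x : R} (hx : ∀ e : E 0, d 0 e = 0 → x • e = 0) : TorsionExact d (𝔟 ⊔ span {x}) 0 := by
  rintro (_ | i) - z hz hzx
  · obtain ⟨w, rfl, hw⟩ := h 0 le_rfl z hz (le_sup_left.trans hzx)
    obtain ⟨n, hn⟩ := mem_radical_torsionOf.1 (hzx (mem_sup_right (mem_span_singleton_self x)))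
    refine ⟨w, rfl, sup_le hw ?_⟩
    rw [span_singleton_le_iff_mem, mem_radical_torsionOf]
    refine ⟨n + 1, ?_⟩
    rw [pow_succ', mul_smul]
    exact hx _ (by rw [map_smul, hn])
  · refine h.sup_span_singleton hd x (i + 1) (by omega) z hz hzx

theorem torsionExact_of_smul_eq_zero [IsNoetherianRing R] [∀ n, Module.Injective R (E n)]
    (hd : ∀ n e, d (n + 1) (d n e) = 0)
    (hex : ∀ i, ∀ z : E (i + 1), d (i + 1) z = 0 → ∃ w, d i w = z)
    (h : ∀ x ∈ 𝔟, ∀ e : E 0, d 0 e = 0 → x • e = 0) : TorsionExact d 𝔟 0 := by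
  classical
  obtain ⟨s, rfl⟩ := IsNoetherian.noetherian 𝔟
  induction s using Finset.induction_on with
  | empty =>
    intro i _ z hz _
    obtain ⟨w, hw⟩ := hex i z hz
    exact ⟨w, hw, by simp⟩
  | insert x s hx ih =>
    rw [Finset.coe_insert, ← Set.union_singleton] at h ⊢
    change TorsionExact d (span _) 0
    rw [span_union]
    exact (ih fun y hy => h y (span_mono Set.subset_union_left hy)).sup_span_singleton_of_smul_eq_zero
      hd (h x (subset_span (by simp)))

end Complex

/-! ### Generation up to radical -/

section Kronecker

variable {R : Type*} [CommRing R] [IsNoetherianRing R]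

/-- If all primes over `K` that do not contain `𝔞` have coheight at most `d` and are not maximal,
then up to radicals `𝔞` is generated modulo `K` by `d` of its elements. -/
theorem exists_finset_le_radical (𝔞 : Ideal R) (d : ℕ) (K : Ideal R)
    (hK : ∀ p : PrimeSpectrum R, K ≤ p.asIdeal → ¬ 𝔞 ≤ p.asIdeal →
      0 < Order.coheight p ∧ Order.coheight p ≤ d) :
    ∃ s : Finset R, s.card ≤ d ∧ (s : Set R) ⊆ 𝔞 ∧ 𝔞 ≤ (span s ⊔ K).radical := by
  classical
  induction d generalizing K with
  | zero =>
    refine ⟨∅, by simp, by simp, ?_⟩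
    rw [radical_eq_sInf]
    refine le_sInf fun p hp => by_contra fun h => ?_
    obtain ⟨h₁, h₂⟩ := hK ⟨p, hp.2⟩ (le_sup_right.trans hp.1) h
    exact absurd h₂ (by simpa using h₁.ne')
  | succ d ih =>
    -- By prime avoidance; a prime over `span {x} ⊔ K` not containing `𝔞` is then strictly above a
    -- minimal prime of `K`, so its coheight drops.
    obtain ⟨x, hx, hxp⟩ : ∃ x ∈ 𝔞, ∀ q ∈ K.minimalPrimes, ¬ 𝔞 ≤ q → x ∉ q := by
      by_contra! H
      have hfin : {q ∈ K.minimalPrimes | ¬ 𝔞 ≤ q}.Finite :=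
        K.finite_minimalPrimes_of_isNoetherianRing.subset fun q hq => hq.1
      obtain ⟨q, hq, hle⟩ := (subset_union_prime_finite hfin (f := id) ⊥ ⊥
        fun q hq _ _ => hq.1.1.1).1 fun x hx => by
          obtain ⟨q, hq, hq', hxq⟩ := H x hx
          exact Set.mem_iUnion₂.2 ⟨q, ⟨hq, hq'⟩, hxq⟩
      exact hq.2 hle
    obtain ⟨s, hs, hsa, hle⟩ := ih (span {x} ⊔ K) fun p hp hap => by
      have hp' := hK p (le_sup_right.trans hp) hap
      refine ⟨hp'.1, ?_⟩
      obtain ⟨q, hq, hqp⟩ := exists_minimalPrimes_le (le_sup_right.trans hp)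
      have haq : ¬ 𝔞 ≤ q := fun h => hap (h.trans hqp)
      let Q : PrimeSpectrum R := ⟨q, hq.1.1⟩
      have hlt : Q < p := lt_of_le_of_ne hqp fun h => hxp q hq haq <| by
        have : q = p.asIdeal := congrArg PrimeSpectrum.asIdeal h
        rw [this]
        exact hp (mem_sup_left (mem_span_singleton_self x))
      have := (Order.coheight_add_one_le hlt).trans (hK Q hq.1.2 haq).2
      push_cast at this
      exact (ENat.add_le_add_iff_right ENat.one_ne_top).1 this
    refine ⟨insert x s, (Finset.card_insert_le _ _).trans (by omega), ?_, ?_⟩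
    · rw [Finset.coe_insert]
      exact Set.insert_subset hx hsa
    · rwa [Finset.coe_insert, ← Set.union_singleton, span_union, sup_assoc]

/-- Modulo a proper ideal `K` with `dim R/K ≤ d`, every proper ideal of a noetherian local ring is
generated by `d` elements up to radicals. -/
theorem exists_finset_le_radical_of_ringKrullDim_le [IsLocalRing R] {𝔞 K : Ideal R} {d : ℕ}
    (h𝔞 : 𝔞 ≠ ⊤) (hd : ringKrullDim (R ⧸ K) ≤ d) :
    ∃ s : Finset R, s.card ≤ d ∧ (s : Set R) ⊆ 𝔞 ∧ 𝔞 ≤ (span s ⊔ K).radical := by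
  refine exists_finset_le_radical 𝔞 d K fun p hp hap => ⟨?_, ?_⟩
  -- The maximal ideal contains `𝔞`, so it is never among the primes to be treated.
  · rw [Order.coheight_pos]
    intro hmax
    have hle : p ≤ IsLocalRing.closedPoint R := IsLocalRing.le_maximalIdeal p.2.ne_top
    exact hap ((IsLocalRing.le_maximalIdeal h𝔞).trans (hmax hle))
  · have h : (Order.coheight p : WithBot ℕ∞) ≤ d := by
      rw [Order.coheight_eq_krullDim_Ici]
      refine le_trans ?_ hd
      rw [ringKrullDim_quotient]
      exact Order.krullDim_le_of_strictMono (fun q => ⟨q.1, hp.trans q.2⟩) fun _ _ h => h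
    exact_mod_cast h

end Kronecker

/-! ### Vanishing of local cohomology -/

section Vanishing

variable {R : Type u} [CommRing R]

theorem mem_torsion_iff {I J : Ideal R} {M : Type u} [AddCommGroup M] [Module R M] {x : M} :
    x ∈ torsion I J M ↔ ∃ n : ℕ, I ^ n ≤ torsionOf R M x ⊔ J :=
  exists_congr fun n => pow_smul_le_iff I J x n

theorem subsingleton_localCohomology_of_isZero {I J : Ideal R} {M : ModuleCat.{u} R}
    (hM : Limits.IsZero M) (i : ℕ) : Subsingleton ((localCohomology I J i).obj M) := by
  have : Injective M := hM.injective
  have hX : Limits.IsZero ((InjectiveResolution.self M).cocomplex.X i) :=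
    (CochainComplex.single₀ _ ⋙ HomologicalComplex.eval _ _ i).map_isZero hM
  apply ModuleCat.subsingleton_of_isZero
  refine Limits.IsZero.of_iso ?_
    ((InjectiveResolution.self M).isoRightDerivedObj (torsionFunctor I J) i)
  exact (HomologicalComplex.exactAt_iff_isZero_homology _ _).1
    (ShortComplex.exact_of_isZero_X₂ _ ((torsionFunctor I J).map_isZero hX))

theorem subsingleton_localCohomology_of_exact {I J : Ideal R} {M : ModuleCat.{u} R}
    (Q : InjectiveResolution M) (i : ℕ)
    (h : ∀ z ∈ torsion I J (Q.cocomplex.X (i + 1)), Q.cocomplex.d (i + 1) (i + 2) z = 0 →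
      ∃ w ∈ torsion I J (Q.cocomplex.X i), Q.cocomplex.d i (i + 1) w = z) :
    Subsingleton ((localCohomology I J (i + 1)).obj M) := by
  apply ModuleCat.subsingleton_of_isZero
  refine Limits.IsZero.of_iso ?_ (Q.isoRightDerivedObj (torsionFunctor I J) (i + 1))
  refine (HomologicalComplex.exactAt_iff_isZero_homology _ _).1 ?_
  rw [HomologicalComplex.exactAt_iff' _ i (i + 1) (i + 2) (by simp) (by simp),
    ShortComplex.moduleCat_exact_iff]
  intro z hz
  obtain ⟨w, hw, hwz⟩ := h z.1 z.2 (congrArg Subtype.val hz)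
  exact ⟨⟨w, hw⟩, Subtype.ext hwz⟩

theorem subsingleton_localCohomology_of_ringKrullDim_lt [IsNoetherianRing R] [IsLocalRing R]
    (I : Ideal R) {J 𝔠 : Ideal R} {M : Type u} [AddCommGroup M] [Module R M]
    (h𝔠 : 𝔠 ≤ Module.annihilator R M) (hJ𝔠 : J ⊔ 𝔠 ≠ ⊤) {i : ℕ}
    (hi : ringKrullDim (R ⧸ (J ⊔ 𝔠)) < i) :
    Subsingleton ((localCohomology I J i).obj (ModuleCat.of R M)) := by
  have hnt : Nontrivial (R ⧸ (J ⊔ 𝔠)) := Ideal.Quotient.nontrivial_iff.2 hJ𝔠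
  obtain _ | i := i
  · exact absurd hi (not_lt.2 ringKrullDim_nonneg_of_nontrivial)
  have hi' : ringKrullDim (R ⧸ (J ⊔ 𝔠)) ≤ i := by
    push_cast at hi
    exact ENat.WithBot.lt_add_one_iff.1 hi
  let Q := injectiveResolution (ModuleCat.of R M)
  let d : ∀ n, Q.cocomplex.X n →ₗ[R] Q.cocomplex.X (n + 1) := fun n =>
    (Q.cocomplex.d n (n + 1)).hom
  have hinj : ∀ n, Module.Injective R (Q.cocomplex.X n) := fun n =>
    Module.injective_module_of_injective_object R _ (inj := Q.injective n)
  have hd : ∀ n e, d (n + 1) (d n e) = 0 := fun n e =>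
    congrArg (fun f => f.hom e) (Q.complex_d_comp n)
  have hex : ∀ n, ∀ z : Q.cocomplex.X (n + 1), d (n + 1) z = 0 → ∃ w, d n w = z := fun n =>
    (ShortComplex.moduleCat_exact_iff _).1 (Q.exact_succ n)
  have hker : ∀ x ∈ 𝔠, ∀ e : Q.cocomplex.X 0, d 0 e = 0 → x • e = 0 := fun x hx e he => by
    obtain ⟨y, rfl⟩ := (ShortComplex.moduleCat_exact_iff _).1
      (ShortComplex.exact_of_f_is_kernel (ShortComplex.mk _ _ Q.ι_f_zero_comp_complex_d)
        Q.isLimitKernelFork) e he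
    have hy : x • y = 0 := (HomologicalComplex.singleObjXSelf (ComplexShape.up ℕ) 0
      (ModuleCat.of R M)).toLinearEquiv.injective <| by
        rw [map_smul, map_zero]
        exact Module.mem_annihilator.1 (h𝔠 hx) _
    change x • (Q.ι.f 0).hom y = 0
    rw [← map_smul, hy, map_zero]
  refine subsingleton_localCohomology_of_exact Q i fun z hz hdz => ?_
  by_cases hz0 : z = 0
  · exact ⟨0, zero_mem _, by rw [hz0, map_zero]⟩
  obtain ⟨n, hn⟩ := mem_torsion_iff.1 hz
  have h𝔞 : torsionOf R _ z ≠ ⊤ := fun h => hz0 <| by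
    rwa [torsionOf_eq_top_iff] at h
  set 𝔞 := torsionOf R _ z
  obtain ⟨s, hs, hs𝔞, h𝔞s⟩ := exists_finset_le_radical_of_ringKrullDim_le h𝔞 hi'
  -- The factor `𝔞` makes the ideal kill `z`, the factor `𝔠` makes `𝔞 ⊓ 𝔠` kill `M`.
  have hT : TorsionExact d (𝔞 ⊓ 𝔠 ⊔ span s) (0 + s.card) :=
    (torsionExact_of_smul_eq_zero hd hex fun x hx => hker x (inf_le_right (a := 𝔞) hx)).sup_span_finset hd s
  obtain ⟨w, hw, hwT⟩ := hT i (by omega) z hdz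
    ((sup_le inf_le_left (span_le.2 hs𝔞)).trans le_radical)
  refine ⟨w, mem_torsion_iff.2 (exists_pow_le_of_le_radical_of_fg ?_
    (IsNoetherian.noetherian I)), hw⟩
  rw [radical_eq_sInf]
  refine le_sInf fun p ⟨hp, hprime⟩ => ?_
  have hJp : J ≤ p := le_sup_right.trans hp
  have hTp : 𝔞 ⊓ 𝔠 ⊔ span s ≤ p :=
    hwT.trans (hprime.radical_le_iff.2 (le_sup_left.trans hp))
  have h𝔞p : 𝔞 ≤ p := by
    rcases hprime.inf_le.1 (le_sup_left.trans hTp) with h | h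
    · exact h
    · exact h𝔞s.trans (hprime.radical_le_iff.2
        (sup_le (le_sup_right.trans hTp) (sup_le hJp h)))
  exact hprime.le_of_pow_le (hn.trans (sup_le h𝔞p hJp))

theorem ringKrullDim_quotient_sup_annihilator_le (J : Ideal R) (M : Type u) [AddCommGroup M]
    [Module R M] [Module.Finite R M] :
    ringKrullDim (R ⧸ (J ⊔ Module.annihilator R M)) ≤
      Module.supportDim R (M ⧸ (J • ⊤ : Submodule R M)) := by
  rw [ringKrullDim_quotient, Module.supportDim, Module.support_quotient,
    Module.support_eq_zeroLocus]
  exact Order.krullDim_le_of_strictMono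
    (fun q => ⟨q.1, SetLike.coe_subset_coe.2 (le_sup_right.trans q.2),
      SetLike.coe_subset_coe.2 (le_sup_left.trans q.2)⟩) fun _ _ h => h

end Vanishing

end PairLocalCohomology

open PairLocalCohomology in
theorem theorem4p3 {R : Type u} [CommRing R] [IsNoetherianRing R] [IsLocalRing R]
    (I J : Ideal R) (hJ : J ≠ ⊤) :
    (∀ (M : Type u) [AddCommGroup M] [Module R M] [Module.Finite R M] (i : ℕ),
      Module.supportDim R (M ⧸ (J • ⊤ : Submodule R M)) < (i : WithBot ℕ∞) →
        Subsingleton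
          ((PairLocalCohomology.localCohomology I J i).obj (ModuleCat.of R M))) ∧
    (∀ (M : Type u) [AddCommGroup M] [Module R M] (i : ℕ),
      ringKrullDim (R ⧸ J) < (i : WithBot ℕ∞) →
        Subsingleton
          ((PairLocalCohomology.localCohomology I J i).obj (ModuleCat.of R M))) := by
  refine ⟨fun M _ _ _ i hi => ?_, fun M _ _ i hi => ?_⟩
  -- For `M = 0` the ideal `J ⊔ Ann M` is not proper, and degree 0 is included.
  · rcases subsingleton_or_nontrivial M with hM | hM
    · exact subsingleton_localCohomology_of_isZero (ModuleCat.isZero_of_subsingleton _) i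
    · have hann : Module.annihilator R M ≠ ⊤ := fun h =>
        not_subsingleton M (Module.annihilator_eq_top_iff.1 h)
      refine subsingleton_localCohomology_of_ringKrullDim_lt I le_rfl (fun h => ?_)
        ((ringKrullDim_quotient_sup_annihilator_le J M).trans_lt hi)
      exact (IsLocalRing.maximalIdeal.isMaximal R).ne_top (top_le_iff.1 (h.ge.trans
        (sup_le (IsLocalRing.le_maximalIdeal hJ) (IsLocalRing.le_maximalIdeal hann))))
  · refine subsingleton_localCohomology_of_ringKrullDim_lt I (𝔠 := ⊥) bot_le ?_ ?_
    · rwa [sup_bot_eq]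
    · rwa [sup_bot_eq]
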